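/- There is an absolute constant $c>0$ such that the following holds for every prime $p$ and every subgroup $\mathcal G$ of the multiplicative group $\mathbb F_p^*$ of the field $\mathbb F_p$ of $p$ elements. Let $D_\times(\mathcal G)$ be the number of solutions to $$(u_1-v_1)(u_2-v_2)=(u_3-v_3)(u_4-v_4),\qquad u_i,v_i\in\mathcal G,\ i=1,2,3,4,$$ where the equation is in $\mathbb F_p$. If $|\mathcal G|\ge (p\log p)^{1/2}$, then $$D_\times(\mathcal G)\le c\,\frac{|\mathcal G|^8}{p}.$$ If $|\mathcal G|<(p\log p)^{1/2}$ and $\mathcal G\neq\{1\}$, then $$D_\times(\mathcal G)\le c\,|\mathcal G|^6\log|\mathcal G|.$$ Here $\log$ is the natural logarithm. -/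

import Mathlib

/-- The number `D_×(U)` of solutions of
`(u₁ - v₁)(u₂ - v₂) = (u₃ - v₃)(u₄ - v₄)` in `𝔽_p` with all `uᵢ, vᵢ ∈ U`, for a set
`U ⊆ 𝔽_p^*`. A solution is a pair `w = (u, v)` with `u, v : Fin 4 → 𝔽_p^*`; the differences and
products are computed in `𝔽_p`. -/
noncomputable def Dtimes (p : ℕ) (U : Set (ZMod p)ˣ) : ℕ :=
  Set.ncard {w : (Fin 4 → (ZMod p)ˣ) × (Fin 4 → (ZMod p)ˣ) |
    (∀ i, w.1 i ∈ U ∧ w.2 i ∈ U) ∧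
    ((w.1 0 : ZMod p) - (w.2 0 : ZMod p)) * ((w.1 1 : ZMod p) - (w.2 1 : ZMod p)) =
      ((w.1 2 : ZMod p) - (w.2 2 : ZMod p)) * ((w.1 3 : ZMod p) - (w.2 3 : ZMod p))}

/-!
Write `t = |G|` and let `H ⊆ 𝔽_p` be the set of elements of `G`, that is, of `t`-th roots of unity.
Apart from the `O(t⁶)` solutions with both sides zero, a solution is a pair of quadruples with a common
ratio `l = (u₁ - v₁) / (u₃ - v₃) = (u₄ - v₄) / (u₂ - v₂)`, so `D_×(G)` is essentially `∑ E(l)²`, where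
`E(l)` counts the nontrivial coincidences `x - l y = x' - l y'` in `H`
(`Dtimes_le`, `offDiagEnergy`). Trivially `∑ E(l) ≤ t⁴` and `E(l) ≤ t³`, and it suffices to know that
`O(t⁶ / τ²)` values of `l` satisfy `E(l) ≥ τ` when `τ` exceeds a multiple of `t² max(1, t² / p)`
(`sq_mul_card_offDiagEnergy_le`): values below this threshold contribute `O(t⁶ + t⁸ / p)` to
`∑ E(l)²`, and the range up to `t³` contributes `O(t⁶ (1 + log t))`, the logarithm coming from a
harmonic sum.

As `E(l) ≤ ∑ R(l, m)²`, where `R(l, m)` is the number of representations `m = x - l y`, the bound for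
`E` follows from the bound `O(t⁴ / s³)` for the number of pairs `(l, m)` with `R(l, m) ≥ s`, for `s`
above a multiple of `max(1, t² / p)` (`pow_three_mul_card_popularPairs_le`). The function `R` is
constant on cosets of `H × H`, and `R(l, m)` counts points `X` with
`(X ^ t, (1 - X) ^ t) = (m ^ (-t), (-l / m) ^ t)`. Stepanov's method bounds by
`O((t K) ^ (2/3))` the number of `X` for which `(X ^ t, (1 - X) ^ t)` is one of `K` given pairs, if
`t⁴ K ≤ p³ / 64` and `K < t² / 8` (`card_powerPairPoints_pow_three_le`). The auxiliary polynomial is a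
combination of the `X ^ (a + t b) (1 - X) ^ (t c)`; it is nonzero since a polynomial of degree less than
`p` with at most `n` terms cannot vanish to order `n` at `1`. When `t⁴` exceeds `p³` the method is void,
but then the variance of `R` over all `(l, m)` gives `R(l, m) = O(t² / p)` directly
(`repCount_sub_sq_le`).
-/

/-! ### Sparse polynomials and orders of vanishing -/

section Stepanov

open Polynomial Finset

variable {p : ℕ} [Fact p.Prime]

/-- A polynomial over `𝔽_p` of degree less than `p` with at most `n` terms cannot vanish to order
`n` at `1` unless it is zero: `X f' - deg f • f` has one term fewer and loses only one order. -/
theorem eq_zero_of_one_sub_X_pow_dvd (n : ℕ) : ∀ f : (ZMod p)[X], #f.support ≤ n →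
    f.natDegree < p → (1 - X : (ZMod p)[X]) ^ n ∣ f → f = 0 := by
  induction n with
  | zero =>
    intro f hs _ _
    simpa using hs
  | succ n ih =>
    intro f hs hd hdvd
    by_contra hf
    set e := f.natDegree with he
    set g : (ZMod p)[X] := X * derivative f - C (e : ZMod p) * f with hg
    have hcoeff : ∀ j, g.coeff j = ((j : ZMod p) - e) * f.coeff j := by
      intro j
      rcases j with _ | j
      · simp [hg]
      · simp [hg, coeff_X_mul, coeff_derivative]; ring
    have hsub : g.support ⊆ f.support.erase e := by
      intro j hj
      rw [mem_support_iff, hcoeff] at hj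
      rw [mem_erase, mem_support_iff]
      refine ⟨?_, right_ne_zero_of_mul hj⟩
      rintro rfl
      simp at hj
    have hemem : e ∈ f.support := by
      rw [mem_support_iff, he]
      exact leadingCoeff_ne_zero.mpr hf
    have hg0 : g = 0 := by
      apply ih
      · have h1 := card_le_card hsub
        rw [card_erase_of_mem hemem] at h1
        omega
      · refine lt_of_le_of_lt ?_ hd
        refine natDegree_le_iff_coeff_eq_zero.mpr fun j hj => ?_
        rw [hcoeff, coeff_eq_zero_of_natDegree_lt hj, mul_zero]
      · refine dvd_sub (Dvd.dvd.mul_left ?_ _) (Dvd.dvd.mul_left ?_ _)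
        · simpa using pow_sub_one_dvd_derivative_of_pow_dvd hdvd
        · exact (pow_dvd_pow _ n.le_succ).trans hdvd
    have hmono : f = monomial e (f.coeff e) := by
      ext j
      rw [coeff_monomial]
      split_ifs with h
      · rw [h]
      · by_cases hj : j ≤ e
        · have h1 := hcoeff j
          rw [hg0, coeff_zero] at h1
          rcases mul_eq_zero.mp h1.symm with h2 | h2
          · exfalso
            rw [sub_eq_zero, ZMod.natCast_eq_natCast_iff'] at h2
            rw [Nat.mod_eq_of_lt (by omega), Nat.mod_eq_of_lt hd] at h2
            exact h h2.symm
          · exact h2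
        · exact coeff_eq_zero_of_natDegree_lt (by omega)
    have h1 : (1 - X : (ZMod p)[X]) ∣ f := (dvd_pow_self _ n.succ_ne_zero).trans hdvd
    have h2 : f.eval 1 = 0 := by
      obtain ⟨q, hq⟩ := h1
      rw [hq]; simp
    rw [hmono] at h2
    simp only [eval_monomial, one_pow, mul_one] at h2
    exact (mem_support_iff.mp hemem) h2

/-- The derivation `X (1 - X) d/dX`. -/
noncomputable def eulerOp (p : ℕ) : Module.End (ZMod p) (ZMod p)[X] :=
  LinearMap.mulLeft (ZMod p) (X * (1 - X)) ∘ₗ derivative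

theorem eulerOp_apply (f : (ZMod p)[X]) : eulerOp p f = X * (1 - X) * derivative f := rfl

/-- If `f, θ f, …, θ ^ (D - 1) f` vanish at `x ≠ 0, 1`, where `θ = X (1 - X) d/dX` and `D ≤ p`, then
`f` vanishes to order `D` at `x`. -/
theorem X_sub_C_pow_dvd_of_eulerOp {x : ZMod p} (hx0 : x ≠ 0) (hx1 : 1 - x ≠ 0) (D : ℕ) :
    ∀ f : (ZMod p)[X], D ≤ p → (∀ k < D, ((eulerOp p ^ k) f).eval x = 0) → (X - C x) ^ D ∣ f := by
  induction D with
  | zero => intro f _ _; simp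
  | succ n ih =>
    intro f hn h
    obtain ⟨r, hr⟩ := ih f (by omega) fun k hk => h k (by omega)
    rcases n with _ | n
    · have := h 0 (by omega)
      simpa [dvd_iff_isRoot] using this
    have h2 : (X - C x) ^ (n + 1) ∣ eulerOp p f := by
      refine ih _ (by omega) fun k hk => ?_
      have := h (k + 1) (by omega)
      rwa [pow_succ] at this
    have h3 : eulerOp p f =
        (X - C x) ^ n * (C ((n : ZMod p) + 1) * (X * (1 - X)) * r +
          (X - C x) * (X * (1 - X) * derivative r)) := by
      rw [eulerOp_apply, hr]
      simp only [derivative_mul, derivative_pow, derivative_sub, derivative_X, derivative_C]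
      simp
      ring
    rw [h3, pow_succ] at h2
    have h4 := (mul_dvd_mul_iff_left (pow_ne_zero n (X_sub_C_ne_zero x))).mp h2
    rw [dvd_add_left (dvd_mul_right _ _), dvd_iff_isRoot, IsRoot] at h4
    have hn0 : (n : ZMod p) + 1 ≠ 0 := by
      intro h0
      have h5 : ((n + 1 : ℕ) : ZMod p) = 0 := by exact_mod_cast h0
      rw [ZMod.natCast_eq_zero_iff] at h5
      exact absurd (Nat.le_of_dvd (by omega) h5) (by omega)
    simp only [eval_mul, eval_C, eval_X, eval_sub, eval_one, mul_eq_zero] at h4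
    have h5 : r.IsRoot x := by
      rcases h4 with (h4 | h4 | h4) | h4
      · exact absurd h4 hn0
      · exact absurd h4 hx0
      · exact absurd h4 hx1
      · exact h4
    obtain ⟨q, hq⟩ := dvd_iff_isRoot.mpr h5
    rw [hr, hq, pow_succ _ (n + 1)]
    exact mul_dvd_mul_left _ (dvd_mul_right _ _)

/-- The operator to which `X (1 - X) d/dX` is conjugated by multiplication by `X ^ u (1 - X) ^ v`. -/
noncomputable def twistedEulerOp (p u v : ℕ) : Module.End (ZMod p) (ZMod p)[X] :=
  LinearMap.mulLeft (ZMod p) (C (u : ZMod p) * (1 - X) - C (v : ZMod p) * X) + eulerOp p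

theorem twistedEulerOp_apply (u v : ℕ) (f : (ZMod p)[X]) :
    twistedEulerOp p u v f =
      (C (u : ZMod p) * (1 - X) - C (v : ZMod p) * X) * f + X * (1 - X) * derivative f := rfl

theorem eulerOp_mul (u v : ℕ) (f : (ZMod p)[X]) :
    eulerOp p (X ^ u * (1 - X) ^ v * f) = X ^ u * (1 - X) ^ v * twistedEulerOp p u v f := by
  rw [eulerOp_apply, twistedEulerOp_apply]
  simp only [derivative_mul, derivative_pow, derivative_sub, derivative_X, derivative_one]
  rcases u with _ | u <;> rcases v with _ | v <;> simp <;> ring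

theorem eulerOp_pow_mul (u v k : ℕ) (f : (ZMod p)[X]) :
    (eulerOp p ^ k) (X ^ u * (1 - X) ^ v * f) =
      X ^ u * (1 - X) ^ v * (twistedEulerOp p u v ^ k) f := by
  induction k with
  | zero => rfl
  | succ k ih => rw [pow_succ', pow_succ', Module.End.mul_apply, ih, eulerOp_mul]; rfl

theorem natDegree_twistedEulerOp_le (u v : ℕ) (f : (ZMod p)[X]) :
    (twistedEulerOp p u v f).natDegree ≤ f.natDegree + 1 := by
  rw [twistedEulerOp_apply]
  refine natDegree_add_le_of_degree_le ?_ ?_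
  · refine natDegree_mul_le.trans ?_
    rw [add_comm]
    gcongr
    compute_degree
  · rcases Nat.eq_zero_or_pos f.natDegree with h | h
    · rw [eq_C_of_natDegree_eq_zero h]
      simp
    · refine natDegree_mul_le.trans ?_
      have h1 := natDegree_derivative_le f
      have h2 : (X * (1 - X) : (ZMod p)[X]).natDegree ≤ 2 := by compute_degree
      omega

theorem natDegree_twistedEulerOp_pow_le (u v k : ℕ) (f : (ZMod p)[X]) :
    ((twistedEulerOp p u v ^ k) f).natDegree ≤ f.natDegree + k := by
  induction k with
  | zero => simp
  | succ k ih =>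
    rw [pow_succ', Module.End.mul_apply]
    have := natDegree_twistedEulerOp_le u v ((twistedEulerOp p u v ^ k) f)
    omega

theorem eq_zero_of_sum_pow_mul_eq_zero {R : Type*} [CommRing R] [IsDomain R] {u : R} (hu : u ≠ 0)
    (n : ℕ) : ∀ h : ℕ → R, (∀ i < n, u ∣ h i → h i = 0) → ∑ i ∈ range n, u ^ i * h i = 0 →
      ∀ i < n, h i = 0 := by
  induction n with
  | zero => intro h _ _ i hi; omega
  | succ n ih =>
    intro h hdvd hsum
    rw [sum_range_succ'] at hsum
    have h1 : ∑ i ∈ range n, u ^ (i + 1) * h (i + 1) = u * ∑ i ∈ range n, u ^ i * h (i + 1) := by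
      rw [mul_sum]
      exact sum_congr rfl fun i _ => by ring
    rw [h1, pow_zero, one_mul] at hsum
    have h0 : h 0 = 0 := by
      refine hdvd 0 (by omega) ⟨-∑ i ∈ range n, u ^ i * h (i + 1), ?_⟩
      linear_combination hsum
    rw [h0, add_zero] at hsum
    have h2 := (mul_eq_zero.mp hsum).resolve_left hu
    have h3 := ih (fun i => h (i + 1)) (fun i hi => hdvd (i + 1) (by omega)) h2
    intro i hi
    rcases i with _ | i
    · exact h0
    · exact h3 i (by omega)

/-- The polynomials `X ^ (a + t b) (1 - X) ^ (t c)` with `a < A` and `b, c < B` are linearly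
independent over `𝔽_p` when `A B ≤ t` and `t B ≤ p`. -/
theorem sum_monomials_ne_zero {t A B : ℕ} (hAB : A * B ≤ t) (htB : t * B ≤ p)
    (c : Fin A × Fin B × Fin B → ZMod p) (hc : c ≠ 0) :
    ∑ i, C (c i) * (X ^ (t * (i.2.1 : ℕ)) * (1 - X) ^ (t * (i.2.2 : ℕ)) * X ^ (i.1 : ℕ)) ≠
      (0 : (ZMod p)[X]) := by
  intro hsum
  apply hc
  let h : ℕ → (ZMod p)[X] := fun k => if hk : k < B then
    ∑ i : Fin A × Fin B, monomial ((i.1 : ℕ) + t * (i.2 : ℕ)) (c (i.1, i.2, ⟨k, hk⟩)) else 0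
  have hinj : ∀ i j : Fin A × Fin B, (i.1 : ℕ) + t * (i.2 : ℕ) = (j.1 : ℕ) + t * (j.2 : ℕ) →
      i = j := by
    rintro ⟨a, b⟩ ⟨a', b'⟩ hij
    simp only at hij
    have hB : 0 < B := b.pos
    have hAt : A ≤ t := (Nat.le_mul_of_pos_right A hB).trans hAB
    have ha : (a : ℕ) < t := a.2.trans_le hAt
    have ha' : (a' : ℕ) < t := a'.2.trans_le hAt
    have h1 : (a : ℕ) = a' := by
      have := congrArg (· % t) hij
      simpa [Nat.add_mul_mod_self_left, Nat.mod_eq_of_lt ha, Nat.mod_eq_of_lt ha'] using this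
    have h2 : (b : ℕ) = b' := by
      rw [h1] at hij
      exact Nat.eq_of_mul_eq_mul_left (by omega) (Nat.add_left_cancel hij)
    exact Prod.ext (Fin.ext h1) (Fin.ext h2)
  have hzero : ∀ k < B, h k = 0 := by
    refine eq_zero_of_sum_pow_mul_eq_zero (u := (1 - X : (ZMod p)[X]) ^ t) ?_ B h ?_ ?_
    · refine pow_ne_zero _ fun h0 => ?_
      have := congrArg (eval 0) h0
      simp at this
    · intro k hk hdvd
      have hle : ∀ i : Fin A × Fin B, (i.1 : ℕ) + t * (i.2 : ℕ) < p := by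
        rintro ⟨a, b⟩
        have hB : 0 < B := b.pos
        have hAt : A ≤ t := (Nat.le_mul_of_pos_right A hB).trans hAB
        have h1 : t * ((b : ℕ) + 1) ≤ t * B := Nat.mul_le_mul_left t b.2
        have := a.2
        simp only
        rw [mul_add] at h1
        omega
      refine eq_zero_of_one_sub_X_pow_dvd t (h k) ?_ ?_ hdvd
      · have hs : (h k).support ⊆
            univ.image fun i : Fin A × Fin B => (i.1 : ℕ) + t * (i.2 : ℕ) := by
          intro j hj
          by_contra hj'
          rw [mem_support_iff] at hj
          apply hj
          simp only [h, hk, dif_pos, finsetSum_coeff, coeff_monomial]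
          refine sum_eq_zero fun i _ => if_neg fun hij => hj' ?_
          exact mem_image.mpr ⟨i, mem_univ _, hij⟩
        refine (card_le_card hs).trans (card_image_le.trans ?_)
        simpa using hAB
      · have hp : 0 < p := (Fact.out : p.Prime).pos
        have : (h k).natDegree ≤ p - 1 := by
          simp only [h, hk, dif_pos]
          refine natDegree_sum_le_of_forall_le _ _ fun i _ => ?_
          refine (natDegree_monomial_le _).trans ?_
          have := hle i
          omega
        omega
    · rw [← hsum, ← Fin.sum_univ_eq_sum_range (fun i => ((1 - X : (ZMod p)[X]) ^ t) ^ i * h i) B]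
      simp only [Fintype.sum_prod_type]
      rw [sum_congr rfl fun (a : Fin A) _ => sum_comm, sum_comm]
      refine sum_congr rfl fun k _ => ?_
      simp only [h, k.2, dif_pos, Fintype.sum_prod_type, mul_sum]
      refine sum_congr rfl fun a _ => sum_congr rfl fun b _ => ?_
      rw [← C_mul_X_pow_eq_monomial, pow_add, pow_mul (1 - X)]
      simp only [Fin.eta]
      ring
  funext ⟨a, b, k⟩
  have h1 := congrArg (fun f => coeff f ((a : ℕ) + t * (b : ℕ))) (hzero k k.2)
  simp only [h, k.2, dif_pos, finsetSum_coeff, coeff_monomial, coeff_zero] at h1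
  rw [sum_eq_single (a, b)] at h1
  · simpa using h1
  · intro i _ hi
    exact if_neg fun hij => hi (hinj _ _ hij)
  · intro hi
    exact absurd (mem_univ _) hi

/-! ### Stepanov's method for the curves `X ^ t = α`, `(1 - X) ^ t = β` -/

theorem card_mul_le_natDegree {f : (ZMod p)[X]} (hf : f ≠ 0) (Z : Finset (ZMod p)) (D : ℕ)
    (h : ∀ x ∈ Z, (X - C x) ^ D ∣ f) : #Z * D ≤ f.natDegree := by
  have h1 : ∏ x ∈ Z, (X - C x) ^ D ∣ f := by
    refine prod_dvd_of_coprime ?_ h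
    intro x _ y _ hxy
    exact (pairwise_coprime_X_sub_C Function.injective_id hxy).pow
  have h2 := natDegree_le_of_dvd h1 hf
  rw [natDegree_prod _ _ fun x _ => pow_ne_zero _ (X_sub_C_ne_zero x)] at h2
  simpa using h2

/-- The points `x ≠ 0, 1` for which `(x ^ t, (1 - x) ^ t)` lies in a given set of pairs. -/
noncomputable def powerPairPoints (t : ℕ) (S : Finset (ZMod p × ZMod p)) : Finset (ZMod p) :=
  {x | x ≠ 0 ∧ 1 - x ≠ 0 ∧ (x ^ t, (1 - x) ^ t) ∈ S}

/-- Stepanov's method: the dimension count `2 K A² < A B²` yields a nonzero polynomial of degree at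
most `2 t B` that vanishes to order `A` at every point of `powerPairPoints t S`. -/
theorem card_powerPairPoints_mul_le {t A B : ℕ} (S : Finset (ZMod p × ZMod p)) (hA : 0 < A)
    (hAB : A * B ≤ t) (htB : t * B ≤ p) (hK : 2 * #S * A < B * B) :
    #(powerPairPoints t S) * A ≤ 2 * (t * B) := by
  have hB : 0 < B := by
    rcases Nat.eq_zero_or_pos B with h | h
    · simp [h] at hK
    · exact h
  have hAt : A ≤ t := (Nat.le_mul_of_pos_right A hB).trans hAB
  have hAp : A ≤ p := hAt.trans ((Nat.le_mul_of_pos_right t hB).trans htB)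
  let L : (Fin A × Fin B × Fin B → ZMod p) →ₗ[ZMod p] (S × Fin A × Fin (2 * A) → ZMod p) :=
    LinearMap.pi fun q => ∑ i, (q.1.1.1 ^ (i.2.1 : ℕ) * q.1.1.2 ^ (i.2.2 : ℕ) *
      ((twistedEulerOp p (t * i.2.1) (t * i.2.2) ^ (q.2.1 : ℕ)) (X ^ (i.1 : ℕ))).coeff q.2.2) •
        LinearMap.proj i
  have hker : LinearMap.ker L ≠ ⊥ := by
    apply LinearMap.ker_ne_bot_of_finrank_lt
    simp only [Module.finrank_fintype_fun_eq_card, Fintype.card_prod, Fintype.card_fin,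
      Fintype.card_coe]
    calc #S * (A * (2 * A)) = A * (2 * #S * A) := by ring
      _ < A * (B * B) := Nat.mul_lt_mul_of_pos_left hK hA
  obtain ⟨c, hcL, hc⟩ := (Submodule.ne_bot_iff _).mp hker
  have hLc : ∀ (q : S) (k : Fin A) (j : Fin (2 * A)), ∑ i : Fin A × Fin B × Fin B,
      (q.1.1 ^ (i.2.1 : ℕ) * q.1.2 ^ (i.2.2 : ℕ) *
      ((twistedEulerOp p (t * i.2.1) (t * i.2.2) ^ (k : ℕ)) (X ^ (i.1 : ℕ))).coeff j) * c i = 0 := by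
    intro q k j
    have := congrFun (LinearMap.mem_ker.mp hcL) (q, k, j)
    simpa [L] using this
  have hne := sum_monomials_ne_zero hAB htB c hc
  set f : (ZMod p)[X] := ∑ i, C (c i) *
    (X ^ (t * (i.2.1 : ℕ)) * (1 - X) ^ (t * (i.2.2 : ℕ)) * X ^ (i.1 : ℕ)) with hf
  have hdeg : f.natDegree ≤ 2 * (t * B) := by
    refine natDegree_sum_le_of_forall_le _ _ fun i _ => ?_
    have h1 : t * ((i.2.1 : ℕ) + 1) ≤ t * B := Nat.mul_le_mul_left t i.2.1.2
    have h2 : t * ((i.2.2 : ℕ) + 1) ≤ t * B := Nat.mul_le_mul_left t i.2.2.2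
    have h3 := i.1.2
    have h4 : (1 - X : (ZMod p)[X]).natDegree ≤ 1 := by compute_degree
    have h5 : ((1 - X : (ZMod p)[X]) ^ (t * (i.2.2 : ℕ))).natDegree ≤ t * (i.2.2 : ℕ) :=
      (natDegree_pow_le_of_le _ h4).trans_eq (mul_one _)
    refine (natDegree_C_mul_le _ _).trans (natDegree_mul_le.trans ?_)
    refine (Nat.add_le_add_right natDegree_mul_le _).trans ?_
    rw [natDegree_X_pow, natDegree_X_pow]
    rw [mul_add] at h1 h2
    omega
  refine (card_mul_le_natDegree hne _ A fun x hx => ?_).trans hdeg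
  obtain ⟨hx0, hx1, hxS⟩ := (mem_filter.mp hx).2
  refine X_sub_C_pow_dvd_of_eulerOp hx0 hx1 A f hAp fun k hk => ?_
  have hstep : ∀ i : Fin A × Fin B × Fin B, ((eulerOp p ^ k) (C (c i) *
      (X ^ (t * (i.2.1 : ℕ)) * (1 - X) ^ (t * (i.2.2 : ℕ)) * X ^ (i.1 : ℕ)))).eval x =
      ∑ j : Fin (2 * A), x ^ (j : ℕ) * (((x ^ t) ^ (i.2.1 : ℕ) * ((1 - x) ^ t) ^ (i.2.2 : ℕ) *
      ((twistedEulerOp p (t * i.2.1) (t * i.2.2) ^ k) (X ^ (i.1 : ℕ))).coeff j) * c i) := by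
    intro i
    have hd : ((twistedEulerOp p (t * i.2.1) (t * i.2.2) ^ k) (X ^ (i.1 : ℕ))).natDegree
        < 2 * A := by
      have h1 := natDegree_twistedEulerOp_pow_le (p := p) (t * i.2.1) (t * i.2.2) k (X ^ (i.1 : ℕ))
      have h2 := i.1.2
      rw [natDegree_X_pow] at h1
      omega
    rw [← smul_eq_C_mul, map_smul, eulerOp_pow_mul, eval_smul, eval_mul, eval_eq_sum_range' hd,
      ← Fin.sum_univ_eq_sum_range (fun j => ((twistedEulerOp p (t * i.2.1) (t * i.2.2) ^ k)
        (X ^ (i.1 : ℕ))).coeff j * x ^ j)]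
    simp only [eval_mul, eval_pow, eval_X, eval_sub, eval_one, smul_eq_mul, mul_sum]
    refine sum_congr rfl fun j _ => ?_
    rw [← pow_mul, ← pow_mul]
    ring
  rw [hf, map_sum, eval_finsetSum, sum_congr rfl fun i _ => hstep i, sum_comm]
  refine sum_eq_zero fun j _ => ?_
  rw [← mul_sum, hLc ⟨_, hxS⟩ ⟨k, hk⟩ j, mul_zero]

/-- The optimal choice of parameters in Stepanov's method: `A ≈ (t² / K) ^ (1/3)` and `B ≈ t / A`. -/
theorem card_powerPairPoints_pow_three_le {t : ℕ} (S : Finset (ZMod p × ZMod p)) (hS : S.Nonempty)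
    (h1 : 8 * #S < t ^ 2) (h2 : 64 * t ^ 4 * #S ≤ p ^ 3) :
    #(powerPairPoints t S) ^ 3 ≤ 2 ^ 15 * t ^ 2 * #S ^ 2 := by
  set K := #S with hKdef
  have hK : 0 < K := card_pos.mpr hS
  set A := Nat.findGreatest (fun A => 8 * K * A ^ 3 < t ^ 2) t with hA
  have hA1 : 8 * K * A ^ 3 < t ^ 2 :=
    Nat.findGreatest_spec (P := fun A => 8 * K * A ^ 3 < t ^ 2) (Nat.zero_le t)
      (by simp; nlinarith)
  have ht : 1 ≤ t := by nlinarith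
  have hA0 : 1 ≤ A := Nat.le_findGreatest ht (by simpa using h1)
  have hA2 : t ^ 2 ≤ 64 * K * A ^ 3 := by
    have h3 : ¬ 8 * K * (A + 1) ^ 3 < t ^ 2 := by
      intro h
      by_cases hAt : A + 1 ≤ t
      · have := Nat.le_findGreatest (P := fun A => 8 * K * A ^ 3 < t ^ 2) hAt h
        omega
      · have h4 : t ^ 2 ≤ (A + 1) ^ 2 := Nat.pow_le_pow_left (by omega) 2
        have h5 : (A + 1) ^ 2 ≤ (A + 1) ^ 3 := Nat.pow_le_pow_right (by omega) (by omega)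
        nlinarith
    have h4 : (A + 1) ^ 3 ≤ (2 * A) ^ 3 := Nat.pow_le_pow_left (by omega) 3
    calc t ^ 2 ≤ 8 * K * (A + 1) ^ 3 := by omega
      _ ≤ 8 * K * (2 * A) ^ 3 := Nat.mul_le_mul_left _ h4
      _ = _ := by ring
  set B := t / A with hB
  have hAB : A * B ≤ t := Nat.mul_div_le t A
  have hAB2 : t < A * B + A := by
    have := Nat.lt_mul_div_succ t hA0
    rwa [mul_add, mul_one] at this
  have hAt : A ≤ t := Nat.findGreatest_le t
  have hB0 : 1 ≤ B := (Nat.one_le_div_iff hA0).mpr hAt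
  have hAB3 : t < 2 * (A * B) := by nlinarith
  have hKB : 2 * K * A < B * B := by
    have h5 : t ^ 2 < (2 * (A * B)) ^ 2 := Nat.pow_lt_pow_left hAB3 (by omega)
    have h6 : 4 * A ^ 2 * (2 * K * A) < 4 * A ^ 2 * (B * B) := by nlinarith
    exact lt_of_mul_lt_mul_left h6 (Nat.zero_le _)
  have htB : t * B ≤ p := by
    have h5 : (t * B) ^ 3 * A ^ 3 ≤ p ^ 3 * A ^ 3 := by
      calc (t * B) ^ 3 * A ^ 3 = t ^ 3 * (A * B) ^ 3 := by ring
        _ ≤ t ^ 3 * t ^ 3 := Nat.mul_le_mul_left _ (Nat.pow_le_pow_left hAB 3)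
        _ = t ^ 4 * t ^ 2 := by ring
        _ ≤ t ^ 4 * (64 * K * A ^ 3) := Nat.mul_le_mul_left _ hA2
        _ = 64 * t ^ 4 * K * A ^ 3 := by ring
        _ ≤ p ^ 3 * A ^ 3 := Nat.mul_le_mul_right _ h2
    have h6 := le_of_mul_le_mul_right h5 (by positivity)
    exact le_of_pow_le_pow_left₀ (by norm_num) (Nat.zero_le _) h6
  have hmain := card_powerPairPoints_mul_le S hA0 hAB htB hKB
  set Z := #(powerPairPoints t S)
  have h7 : Z * A ^ 2 ≤ 2 * t ^ 2 := by nlinarith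
  have h8 : Z ^ 3 * A ^ 6 ≤ 2 ^ 15 * t ^ 2 * K ^ 2 * A ^ 6 := by
    calc Z ^ 3 * A ^ 6 = (Z * A ^ 2) ^ 3 := by ring
      _ ≤ (2 * t ^ 2) ^ 3 := Nat.pow_le_pow_left h7 3
      _ = 8 * t ^ 2 * (t ^ 2) ^ 2 := by ring
      _ ≤ 8 * t ^ 2 * (64 * K * A ^ 3) ^ 2 := Nat.mul_le_mul_left _ (Nat.pow_le_pow_left hA2 2)
      _ = _ := by ring
  exact le_of_mul_le_mul_right h8 (by positivity)

end Stepanov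

/-! ### Representations `x - l y = m` with `x`, `y` in a subgroup -/

section Representations

open Finset

variable {p : ℕ} [Fact p.Prime]

/-- The number of representations `m = x - l y` with `x, y ∈ H`. -/
def repCount (H : Finset (ZMod p)) (l m : ZMod p) : ℕ :=
  #{z ∈ H ×ˢ H | z.1 - l * z.2 = m}

theorem sum_repCount (H : Finset (ZMod p)) (l : ZMod p) : ∑ m, repCount H l m = #H ^ 2 := by
  rw [sq, ← card_product]
  exact (card_eq_sum_card_fiberwise fun _ _ => mem_coe.mpr (mem_univ _)).symm

theorem repCount_le (H : Finset (ZMod p)) (l m : ZMod p) : repCount H l m ≤ #H := by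
  refine card_le_card_of_injOn (fun z => z.2) ?_ ?_
  · intro z hz
    simp only [coe_filter, mem_product, Set.mem_ofPred_eq] at hz
    exact hz.1.2
  · intro z hz w hw hzw
    simp only [coe_filter, mem_product, Set.mem_ofPred_eq] at hz hw hzw
    refine Prod.ext ?_ hzw
    have h1 := hz.2
    rw [hzw] at h1
    linear_combination h1 - hw.2

theorem sum_card_fiber_sq {ι κ : Type*} [Fintype κ] [DecidableEq κ] (s : Finset ι) (f : ι → κ) :
    ∑ k, #{i ∈ s | f i = k} ^ 2 = ∑ i ∈ s, ∑ j ∈ s, if f i = f j then 1 else 0 := by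
  have h : ∀ k, #{i ∈ s | f i = k} ^ 2 =
      ∑ i ∈ s, ∑ j ∈ s, if f i = k then (if f j = k then 1 else 0) else 0 := by
    intro k
    rw [sq, card_filter, sum_mul_sum]
    refine sum_congr rfl fun i _ => sum_congr rfl fun j _ => ?_
    split_ifs <;> rfl
  rw [sum_congr rfl fun k _ => h k, sum_comm]
  refine sum_congr rfl fun i _ => ?_
  rw [sum_comm]
  refine sum_congr rfl fun j _ => ?_
  rw [sum_ite_eq univ (f i)]
  simp [eq_comm]

/-- Two distinct points `(x, y)` lie on a common line `x - l y = m` for at most one slope `l`. -/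
theorem sum_repCount_sq_le (H : Finset (ZMod p)) :
    ∑ l, ∑ m, repCount H l m ^ 2 ≤ p * #H ^ 2 + #H ^ 4 := by
  simp only [repCount, sum_card_fiber_sq]
  rw [sum_comm]
  have key : ∀ z w : ZMod p × ZMod p,
      (∑ l, if z.1 - l * z.2 = w.1 - l * w.2 then 1 else 0) ≤ (if z = w then p else 0) + 1 := by
    intro z w
    split_ifs with hzw
    · refine (sum_le_card_nsmul univ _ 1 fun l _ => by split_ifs <;> simp).trans ?_
      simp [ZMod.card]
    · rw [← card_filter, zero_add, card_le_one]
      intro l hl l' hl'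
      simp only [mem_filter, mem_univ, true_and] at hl hl'
      by_cases h : z.2 = w.2
      · refine absurd (Prod.ext ?_ h) hzw
        rw [h] at hl
        linear_combination hl
      · refine mul_right_cancel₀ (sub_ne_zero.mpr h) ?_
        linear_combination hl' - hl
  calc ∑ z ∈ H ×ˢ H, ∑ l, ∑ w ∈ H ×ˢ H, (if z.1 - l * z.2 = w.1 - l * w.2 then 1 else 0)
      = ∑ z ∈ H ×ˢ H, ∑ w ∈ H ×ˢ H, ∑ l, (if z.1 - l * z.2 = w.1 - l * w.2 then 1 else 0) :=
        sum_congr rfl fun z _ => sum_comm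
    _ ≤ ∑ z ∈ H ×ˢ H, ∑ w ∈ H ×ˢ H, ((if z = w then p else 0) + 1) :=
        sum_le_sum fun z _ => sum_le_sum fun w _ => key z w
    _ = ∑ z ∈ H ×ˢ H, (p + #(H ×ˢ H)) := by
        refine sum_congr rfl fun z hz => ?_
        rw [sum_add_distrib, sum_ite_eq, if_pos hz]
        simp
    _ = p * #H ^ 2 + #H ^ 4 := by
        rw [sum_const, card_product, smul_eq_mul]; ring

/-- The variance bound for the representation function. -/
theorem sum_repCount_sub_sq_le (H : Finset (ZMod p)) :
    ∑ l, ∑ m, ((repCount H l m : ℝ) - (#H : ℝ) ^ 2 / p) ^ 2 ≤ p * (#H : ℝ) ^ 2 := by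
  have hp : (p : ℝ) ≠ 0 := by exact_mod_cast (Fact.out : p.Prime).ne_zero
  have h1 : ∀ l, ∑ m, (repCount H l m : ℝ) = (#H : ℝ) ^ 2 := fun l => by
    exact_mod_cast sum_repCount H l
  have h2 : ∑ l, ∑ m, (repCount H l m : ℝ) ^ 2 ≤ p * (#H : ℝ) ^ 2 + (#H : ℝ) ^ 4 := by
    exact_mod_cast sum_repCount_sq_le H
  have h3 : ∀ l, ∑ m, ((repCount H l m : ℝ) - (#H : ℝ) ^ 2 / p) ^ 2 =
      ∑ m, (repCount H l m : ℝ) ^ 2 - (#H : ℝ) ^ 4 / p := by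
    intro l
    simp only [sub_sq, sum_add_distrib, sum_sub_distrib]
    rw [← sum_mul, ← mul_sum, h1]
    simp only [sum_const, card_univ, ZMod.card, nsmul_eq_mul]
    field_simp
    ring
  rw [sum_congr rfl fun l _ => h3 l, sum_sub_distrib]
  simp only [sum_const, card_univ, ZMod.card, nsmul_eq_mul]
  rw [mul_div_cancel₀ _ hp]
  linarith

variable {t : ℕ} {H : Finset (ZMod p)}

theorem repCount_le_repCount_mul (ht : t ≠ 0) (hH : ∀ x, x ∈ H ↔ x ^ t = 1) {g h : ZMod p}
    (hg : g ∈ H) (hh : h ∈ H) (l m : ZMod p) :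
    repCount H l m ≤ repCount H (g * l) (h * m) := by
  have hne : ∀ x ∈ H, x ≠ 0 := by
    rintro x hx rfl
    rw [hH, zero_pow ht] at hx
    exact zero_ne_one hx
  refine card_le_card_of_injOn (fun z => (h * z.1, h * g⁻¹ * z.2)) ?_ ?_
  · intro z hz
    simp only [coe_filter, mem_product, Set.mem_ofPred_eq] at hz ⊢
    refine ⟨⟨?_, ?_⟩, ?_⟩
    · rw [hH, mul_pow, (hH _).mp hh, (hH _).mp hz.1.1, one_mul]
    · rw [hH, mul_pow, mul_pow, inv_pow, (hH _).mp hh, (hH _).mp hg, (hH _).mp hz.1.2]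
      simp
    · have := hne g hg
      rw [← hz.2]
      field_simp
  · intro z _ w _ hzw
    have h1 := hne g hg
    have h2 := hne h hh
    simp only [Prod.mk.injEq] at hzw
    exact Prod.ext (mul_left_cancel₀ h2 hzw.1)
      (mul_left_cancel₀ (mul_ne_zero h2 (inv_ne_zero h1)) hzw.2)

theorem repCount_mul (ht : t ≠ 0) (hH : ∀ x, x ∈ H ↔ x ^ t = 1) {g h : ZMod p}
    (hg : g ∈ H) (hh : h ∈ H) (l m : ZMod p) :
    repCount H (g * l) (h * m) = repCount H l m := by
  refine le_antisymm ?_ (repCount_le_repCount_mul ht hH hg hh l m)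
  have hne : ∀ x ∈ H, x ≠ 0 := by
    rintro x hx rfl
    rw [hH, zero_pow ht] at hx
    exact zero_ne_one hx
  have hinv : ∀ x ∈ H, x⁻¹ ∈ H := fun x hx => by rw [hH, inv_pow, (hH _).mp hx, inv_one]
  have := repCount_le_repCount_mul ht hH (hinv g hg) (hinv h hh) (g * l) (h * m)
  rwa [inv_mul_cancel_left₀ (hne g hg), inv_mul_cancel_left₀ (hne h hh)] at this

/-- The value at `(l, m)` is repeated on the `t²` points of the orbit of `(l, m)` under `H × H`, so
the variance bound is a pointwise bound. -/
theorem repCount_sub_sq_le (ht : t ≠ 0) (hH : ∀ x, x ∈ H ↔ x ^ t = 1) (hc : #H = t) {l m : ZMod p}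
    (hl : l ≠ 0) (hm : m ≠ 0) : ((repCount H l m : ℝ) - (t : ℝ) ^ 2 / p) ^ 2 ≤ p := by
  have h1 := sum_repCount_sub_sq_le H
  rw [hc, ← Fintype.sum_prod_type'
    (fun l m => ((repCount H l m : ℝ) - (t : ℝ) ^ 2 / p) ^ 2)] at h1
  have hinj : Set.InjOn (fun z : ZMod p × ZMod p => (z.1 * l, z.2 * m)) (H ×ˢ H : Finset _) := by
    intro z _ w _ hzw
    simp only [Prod.mk.injEq] at hzw
    exact Prod.ext (mul_right_cancel₀ hl hzw.1) (mul_right_cancel₀ hm hzw.2)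
  have h2 : ∑ x ∈ (H ×ˢ H).image (fun z : ZMod p × ZMod p => (z.1 * l, z.2 * m)),
      ((repCount H x.1 x.2 : ℝ) - (t : ℝ) ^ 2 / p) ^ 2 =
      (t : ℝ) ^ 2 * ((repCount H l m : ℝ) - (t : ℝ) ^ 2 / p) ^ 2 := by
    rw [sum_image hinj]
    rw [sum_congr rfl (g := fun _ => ((repCount H l m : ℝ) - (t : ℝ) ^ 2 / p) ^ 2)]
    · rw [sum_const, card_product, hc, nsmul_eq_mul]
      push_cast
      ring
    · intro z hz
      rw [mem_product] at hz
      simp only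
      rw [repCount_mul ht hH hz.1 hz.2]
  have h3 := sum_le_sum_of_subset_of_nonneg (subset_univ
      ((H ×ˢ H).image (fun z : ZMod p × ZMod p => (z.1 * l, z.2 * m))))
    (f := fun x => ((repCount H x.1 x.2 : ℝ) - (t : ℝ) ^ 2 / p) ^ 2)
    fun _ _ _ => sq_nonneg _
  rw [h2] at h3
  have h4 : (0 : ℝ) < (t : ℝ) ^ 2 := by positivity
  have h5 := h3.trans h1
  rw [mul_comm (p : ℝ)] at h5
  exact le_of_mul_le_mul_left h5 h4

/-- The substitution `X = x / m` turns a representation `x - l y = m` into a point of the curve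
`X ^ t = α`, `(1 - X) ^ t = β`. -/
theorem repCount_le_card_powerPairPoints (ht : t ≠ 0) (hH : ∀ x, x ∈ H ↔ x ^ t = 1) {l m : ZMod p}
    (hl : l ≠ 0) (hm : m ≠ 0) :
    repCount H l m ≤ #(powerPairPoints t {((m ^ t)⁻¹, (-l / m) ^ t)}) := by
  have hne : ∀ x ∈ H, x ≠ 0 := by
    rintro x hx rfl
    rw [hH, zero_pow ht] at hx
    exact zero_ne_one hx
  refine card_le_card_of_injOn (fun z => z.1 / m) ?_ ?_
  · intro z hz
    simp only [coe_filter, mem_product, Set.mem_ofPred_eq] at hz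
    simp only [powerPairPoints, mem_singleton, coe_filter, mem_univ, true_and, Set.mem_ofPred_eq]
    have h1 : 1 - z.1 / m = -l / m * z.2 := by
      field_simp
      linear_combination -hz.2
    rw [h1]
    refine ⟨div_ne_zero (hne _ hz.1.1) hm,
      mul_ne_zero (div_ne_zero (neg_ne_zero.mpr hl) hm) (hne _ hz.1.2), ?_⟩
    rw [div_pow, (hH _).mp hz.1.1, mul_pow, (hH _).mp hz.1.2, one_div, mul_one]
  · intro z hz w hw hzw
    simp only [coe_filter, mem_product, Set.mem_ofPred_eq] at hz hw
    have h1 : z.1 = w.1 := by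
      simpa [div_left_inj' hm] using hzw
    refine Prod.ext h1 (mul_left_cancel₀ hl ?_)
    linear_combination h1 - hz.2 + hw.2

/-- The sets of points attached to different pairs are disjoint. -/
theorem mul_card_le_card_powerPairPoints {s : ℕ} (S : Finset (ZMod p × ZMod p))
    (h : ∀ q ∈ S, s ≤ #(powerPairPoints t {q})) : s * #S ≤ #(powerPairPoints t S) := by
  have h1 : #(powerPairPoints t S) =
      ∑ q ∈ S, #{x ∈ powerPairPoints t S | (x ^ t, (1 - x) ^ t) = q} := by
    refine card_eq_sum_card_fiberwise fun x hx => ?_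
    exact (mem_filter.mp hx).2.2.2
  rw [h1, mul_comm, ← smul_eq_mul]
  refine card_nsmul_le_sum _ _ _ fun q hq => (h q hq).trans (card_le_card fun x hx => ?_)
  simp only [powerPairPoints, mem_filter, mem_univ, true_and, mem_singleton] at hx ⊢
  exact ⟨⟨hx.1, hx.2.1, hx.2.2 ▸ hq⟩, hx.2.2⟩

/-- The pairs `(l, m)` of nonzero elements with at least `s` representations `m = x - l y`. -/
def popularPairs (H : Finset (ZMod p)) (s : ℕ) : Finset (ZMod p × ZMod p) :=
  {q | q.1 ≠ 0 ∧ q.2 ≠ 0 ∧ s ≤ repCount H q.1 q.2}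

/-- Above the level `max(1, t² / p)`, up to a constant, there are `O(t⁴ / s³)` pairs with at least
`s` representations. Stepanov's method is applied to the smallest set of orbits that would
contradict the bound; the pointwise bound `repCount_sub_sq_le` ensures that `t⁴` is below `p³`, as
required even for a single orbit. -/
theorem pow_three_mul_card_popularPairs_le (ht : t ≠ 0) (hH : ∀ x, x ∈ H ↔ x ^ t = 1) (hc : #H = t)
    {s : ℕ} (hs1 : 256 ≤ s) (hs2 : 256 * t ^ 2 ≤ s * p) :
    s ^ 3 * #(popularPairs H s) ≤ 2 ^ 15 * t ^ 4 := by
  have hp : 0 < p := (Fact.out : p.Prime).pos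
  set φ : ZMod p × ZMod p → ZMod p × ZMod p := fun q => ((q.2 ^ t)⁻¹, (-q.1 / q.2) ^ t) with hφ
  set S := (popularPairs H s).image φ with hS
  have hmem : ∀ q ∈ popularPairs H s, q.1 ≠ 0 ∧ q.2 ≠ 0 ∧ s ≤ repCount H q.1 q.2 := by
    intro q hq
    simpa [popularPairs] using hq
  have hfiber : #(popularPairs H s) ≤ t ^ 2 * #S := by
    refine card_le_mul_card_image _ _ fun r hr => ?_
    obtain ⟨q, hq, rfl⟩ := mem_image.mp hr
    obtain ⟨hq1, hq2, -⟩ := hmem q hq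
    rw [← hc, sq, ← card_product]
    refine card_le_card_of_injOn (fun x => (x.1 / q.1, x.2 / q.2)) ?_ ?_
    · intro x hx
      rw [mem_coe, mem_filter] at hx
      obtain ⟨hx0, hx⟩ := hx
      obtain ⟨hx1, hx2, -⟩ := hmem x hx0
      simp only [hφ, Prod.mk.injEq, inv_inj] at hx
      rw [mem_coe, mem_product, hH, hH, div_pow, div_pow, hx.1,
        div_self (pow_ne_zero _ hq2)]
      refine ⟨?_, rfl⟩
      have h1 := hx.2
      rw [div_pow, div_pow, hx.1, div_left_inj' (pow_ne_zero _ hq2), neg_pow, neg_pow q.1] at h1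
      have h2 := mul_left_cancel₀ (pow_ne_zero t (neg_ne_zero.mpr one_ne_zero)) h1
      rw [h2, div_self (pow_ne_zero _ hq1)]
    · intro x _ y _ hxy
      simp only [Prod.mk.injEq, div_left_inj' hq1, div_left_inj' hq2] at hxy
      exact Prod.ext hxy.1 hxy.2
  have hpts : ∀ q ∈ S, s ≤ #(powerPairPoints t {q}) := by
    intro r hr
    obtain ⟨q, hq, rfl⟩ := mem_image.mp hr
    obtain ⟨hq1, hq2, hq3⟩ := hmem q hq
    exact hq3.trans (repCount_le_card_powerPairPoints ht hH hq1 hq2)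
  suffices h : s ^ 3 * #S ≤ 2 ^ 15 * t ^ 2 by
    calc s ^ 3 * #(popularPairs H s) ≤ s ^ 3 * (t ^ 2 * #S) := Nat.mul_le_mul_left _ hfiber
      _ = t ^ 2 * (s ^ 3 * #S) := by ring
      _ ≤ t ^ 2 * (2 ^ 15 * t ^ 2) := Nat.mul_le_mul_left _ h
      _ = _ := by ring
  by_contra! hcon
  have hs3 : 0 < s ^ 3 := by positivity
  -- The least `k` with `s³ k > 2 ^ 15 t²`; Stepanov's bound for `k` of the pairs is contradictory.
  set k := 2 ^ 15 * t ^ 2 / s ^ 3 + 1 with hk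
  have hk1 : 2 ^ 15 * t ^ 2 < s ^ 3 * k := Nat.lt_mul_div_succ _ hs3
  have hk2 : s ^ 3 * k ≤ 2 ^ 15 * t ^ 2 + s ^ 3 := by
    rw [hk, mul_add, mul_one]
    exact Nat.add_le_add_right (Nat.mul_div_le _ _) _
  have hkS : k ≤ #S := by
    have := (Nat.div_lt_iff_lt_mul hs3).mpr (hcon.trans_eq (mul_comm _ _))
    exact Nat.succ_le_of_lt this
  obtain ⟨T, hTS, hT⟩ := exists_subset_card_eq hkS
  have hTne : T.Nonempty := by
    rw [← card_pos, hT]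
    exact Nat.succ_pos _
  obtain ⟨q, hq⟩ : (popularPairs H s).Nonempty := by
    obtain ⟨r, hr⟩ := hTne
    obtain ⟨q, hq, -⟩ := mem_image.mp (hTS hr)
    exact ⟨q, hq⟩
  obtain ⟨hq1, hq2, hq3⟩ := hmem q hq
  have hst : s ≤ t := hc ▸ hq3.trans (repCount_le H _ _)
  have hs4 : 2 ^ 24 ≤ s ^ 3 := by
    calc 2 ^ 24 = 256 ^ 3 := by norm_num
      _ ≤ s ^ 3 := Nat.pow_le_pow_left hs1 3
  have hcond1 : 8 * #T < t ^ 2 := by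
    rw [hT]
    have h1 : 2 ^ 16 ≤ t ^ 2 := by
      calc 2 ^ 16 = 256 ^ 2 := by norm_num
        _ ≤ t ^ 2 := Nat.pow_le_pow_left (hs1.trans hst) 2
    have h2 : s ^ 3 * (8 * k) < s ^ 3 * t ^ 2 := by nlinarith
    exact lt_of_mul_lt_mul_left h2 (Nat.zero_le _)
  have ht4 : 128 * t ^ 4 ≤ p ^ 3 := by
    have h1 := repCount_sub_sq_le ht hH hc hq1 hq2
    have hp' : (0 : ℝ) < p := by exact_mod_cast hp
    have h2 : (256 : ℝ) * ((t : ℝ) ^ 2 / p) ≤ repCount H q.1 q.2 := by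
      have h3 : (256 : ℝ) * (t : ℝ) ^ 2 ≤ s * p := by exact_mod_cast hs2
      have h4 : (s : ℝ) ≤ repCount H q.1 q.2 := by exact_mod_cast hq3
      refine le_trans ?_ h4
      rw [← mul_div_assoc, div_le_iff₀ hp']
      exact h3
    have h3 : (255 * ((t : ℝ) ^ 2 / p)) ^ 2 ≤ p := by
      refine le_trans ?_ h1
      refine pow_le_pow_left₀ (by positivity) ?_ 2
      linarith
    have h4 : (255 : ℝ) ^ 2 * (t : ℝ) ^ 4 ≤ (p : ℝ) ^ 3 := by
      have h5 : (255 * ((t : ℝ) ^ 2 / p)) ^ 2 * (p : ℝ) ^ 2 = (255 : ℝ) ^ 2 * (t : ℝ) ^ 4 := by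
        field_simp
      rw [← h5]
      calc _ ≤ (p : ℝ) * (p : ℝ) ^ 2 := by gcongr
        _ = _ := by ring
    have h6 : (128 : ℝ) * (t : ℝ) ^ 4 ≤ (p : ℝ) ^ 3 := by
      refine le_trans ?_ h4
      gcongr
      norm_num
    exact_mod_cast h6
  have hcond2 : 64 * t ^ 4 * #T ≤ p ^ 3 := by
    rw [hT]
    have h1 : 2 ^ 24 * t ^ 6 ≤ s ^ 3 * p ^ 3 := by
      calc 2 ^ 24 * t ^ 6 = (256 * t ^ 2) ^ 3 := by ring
        _ ≤ (s * p) ^ 3 := Nat.pow_le_pow_left hs2 3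
        _ = _ := by ring
    have h2 : s ^ 3 * (64 * t ^ 4 * k) ≤ s ^ 3 * p ^ 3 := by
      calc s ^ 3 * (64 * t ^ 4 * k) = 64 * t ^ 4 * (s ^ 3 * k) := by ring
        _ ≤ 64 * t ^ 4 * (2 ^ 15 * t ^ 2 + s ^ 3) := Nat.mul_le_mul_left _ hk2
        _ = 2 ^ 21 * t ^ 6 + s ^ 3 * (64 * t ^ 4) := by ring
        _ ≤ s ^ 3 * p ^ 3 := by
          have h3 : s ^ 3 * (128 * t ^ 4) ≤ s ^ 3 * p ^ 3 := Nat.mul_le_mul_left _ ht4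
          have h4 := Nat.zero_le (s ^ 3 * p ^ 3)
          linarith
    exact le_of_mul_le_mul_left h2 hs3
  have h1 := card_powerPairPoints_pow_three_le T hTne hcond1 hcond2
  have h2 := mul_card_le_card_powerPairPoints T fun q hq => hpts q (hTS hq)
  rw [hT] at h1 h2
  have h3 : s ^ 3 * k * k ^ 2 ≤ 2 ^ 15 * t ^ 2 * k ^ 2 := by
    calc s ^ 3 * k * k ^ 2 = (s * k) ^ 3 := by ring
      _ ≤ _ := (Nat.pow_le_pow_left h2 3).trans h1
  have h4 := le_of_mul_le_mul_right h3 (by positivity)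
  omega

end Representations

/-! ### Second moments from distribution bounds -/

section Moments

open Finset

/-- Summation by parts over the level sets of `f`. -/
theorem sum_sq_le_sum_card_levels {ι : Type*} (s : Finset ι) (f : ι → ℕ) (a M : ℕ)
    (hM : ∀ i ∈ s, f i ≤ M) :
    ∑ i ∈ s with a ≤ f i, f i ^ 2 ≤
      a ^ 2 * #{i ∈ s | a ≤ f i} + ∑ j ∈ Ioc a M, 2 * j * #{i ∈ s | j ≤ f i} := by
  have h1 : ∀ n, a ≤ n → n ^ 2 ≤ a ^ 2 + ∑ j ∈ Ioc a n, 2 * j := by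
    intro n hn
    induction n, hn using Nat.le_induction with
    | base => simp
    | succ n hn ih =>
      rw [sum_Ioc_succ_top hn]
      linarith
  have h2 : ∀ i ∈ s, a ≤ f i →
      f i ^ 2 ≤ a ^ 2 + ∑ j ∈ Ioc a M, if j ≤ f i then 2 * j else 0 := by
    intro i hi hai
    rw [← sum_filter]
    refine (h1 _ hai).trans (Nat.add_le_add_left (sum_le_sum_of_subset fun j hj => ?_) _)
    have := hM i hi
    rw [mem_Ioc] at hj
    rw [mem_filter, mem_Ioc]
    omega
  calc ∑ i ∈ s with a ≤ f i, f i ^ 2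
      ≤ ∑ i ∈ s with a ≤ f i, (a ^ 2 + ∑ j ∈ Ioc a M, if j ≤ f i then 2 * j else 0) :=
        sum_le_sum fun i hi => h2 i (mem_filter.mp hi).1 (mem_filter.mp hi).2
    _ = a ^ 2 * #{i ∈ s | a ≤ f i} +
        ∑ j ∈ Ioc a M, ∑ i ∈ s with a ≤ f i, (if j ≤ f i then 2 * j else 0) := by
        rw [sum_add_distrib, sum_comm, sum_const, smul_eq_mul, mul_comm]
    _ ≤ _ := by
        refine Nat.add_le_add_left (sum_le_sum fun j _ => ?_) _
        refine (sum_le_sum_of_subset (filter_subset _ s)).trans ?_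
        rw [← sum_filter, sum_const, smul_eq_mul, mul_comm]

theorem sum_sq_mul_le_of_pow_three_mul_card_le {ι : Type*} (s : Finset ι) (f : ι → ℕ) {a : ℕ}
    (ha : 0 < a) {K : ℝ} (hK : ∀ j, a ≤ j → (j : ℝ) ^ 3 * #{i ∈ s | j ≤ f i} ≤ K) :
    (∑ i ∈ s with a ≤ f i, (f i : ℝ) ^ 2) * a ≤ 3 * K := by
  have ha' : (0 : ℝ) < a := by exact_mod_cast ha
  have hK0 : 0 ≤ K := le_trans (by positivity) (hK a le_rfl)
  have h1 : (∑ i ∈ s with a ≤ f i, (f i : ℝ) ^ 2) ≤ (a : ℝ) ^ 2 * #{i ∈ s | a ≤ f i} +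
      ∑ j ∈ Ioc a (max a (s.sup f)), 2 * (j : ℝ) * #{i ∈ s | j ≤ f i} := by
    exact_mod_cast sum_sq_le_sum_card_levels s f a (max a (s.sup f))
      fun i hi => (le_sup hi).trans (le_max_right _ _)
  have h2 : ∑ j ∈ Ioc a (max a (s.sup f)), 2 * (j : ℝ) * #{i ∈ s | j ≤ f i} ≤ 2 * K / a := by
    calc ∑ j ∈ Ioc a (max a (s.sup f)), 2 * (j : ℝ) * #{i ∈ s | j ≤ f i}
        ≤ ∑ j ∈ Ioc a (max a (s.sup f)), 2 * K * ((j : ℝ) ^ 2)⁻¹ := by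
          refine sum_le_sum fun j hj => ?_
          have haj := (mem_Ioc.mp hj).1
          have hj0 : (0 : ℝ) < j := by exact_mod_cast ha.trans haj
          rw [← div_eq_mul_inv, le_div_iff₀ (by positivity)]
          linarith [hK j haj.le]
      _ ≤ 2 * K * ((a : ℝ)⁻¹ - ((max a (s.sup f) : ℕ) : ℝ)⁻¹) := by
          rw [← mul_sum]
          exact mul_le_mul_of_nonneg_left (sum_Ioc_inv_sq_le_sub ha.ne' (le_max_left _ _))
            (by positivity)
      _ ≤ 2 * K / a := by
          rw [div_eq_mul_inv]
          refine mul_le_mul_of_nonneg_left (sub_le_self _ (by positivity)) (by positivity)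
  have h3 : (a : ℝ) ^ 2 * #{i ∈ s | a ≤ f i} ≤ K / a := by
    rw [le_div_iff₀ ha']
    linarith [hK a le_rfl]
  rw [← le_div_iff₀ ha']
  calc _ ≤ K / a + 2 * K / a := h1.trans (add_le_add h3 h2)
    _ = 3 * K / a := by ring

theorem sum_sq_le_of_sq_mul_card_le {ι : Type*} (s : Finset ι) (f : ι → ℕ) {a M : ℕ}
    (ha : 0 < a) (hM : ∀ i ∈ s, f i ≤ M) {K : ℝ}
    (hK : ∀ j, a ≤ j → (j : ℝ) ^ 2 * #{i ∈ s | j ≤ f i} ≤ K) :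
    ∑ i ∈ s with a ≤ f i, (f i : ℝ) ^ 2 ≤ K * (3 + 2 * Real.log M) := by
  have hK0 : 0 ≤ K := le_trans (by positivity) (hK a le_rfl)
  have h1 : (∑ i ∈ s with a ≤ f i, (f i : ℝ) ^ 2) ≤ (a : ℝ) ^ 2 * #{i ∈ s | a ≤ f i} +
      ∑ j ∈ Ioc a M, 2 * (j : ℝ) * #{i ∈ s | j ≤ f i} := by
    exact_mod_cast sum_sq_le_sum_card_levels s f a M hM
  have h2 : ∑ j ∈ Ioc a M, 2 * (j : ℝ) * #{i ∈ s | j ≤ f i} ≤ 2 * K * (1 + Real.log M) := by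
    calc ∑ j ∈ Ioc a M, 2 * (j : ℝ) * #{i ∈ s | j ≤ f i}
        ≤ ∑ j ∈ Ioc a M, 2 * K * (j : ℝ)⁻¹ := by
          refine sum_le_sum fun j hj => ?_
          have haj := (mem_Ioc.mp hj).1
          have hj0 : (0 : ℝ) < j := by exact_mod_cast ha.trans haj
          rw [← div_eq_mul_inv, le_div_iff₀ hj0]
          linarith [hK j haj.le]
      _ ≤ ∑ j ∈ Icc 1 M, 2 * K * (j : ℝ)⁻¹ := by
          refine sum_le_sum_of_subset_of_nonneg (fun j hj => ?_) fun j _ _ => by positivity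
          rw [mem_Ioc] at hj
          rw [mem_Icc]
          omega
      _ ≤ 2 * K * (1 + Real.log M) := by
          rw [← mul_sum]
          refine mul_le_mul_of_nonneg_left ?_ (by positivity)
          have := harmonic_le_one_add_log M
          rw [harmonic_eq_sum_Icc] at this
          push_cast at this
          exact this
  linarith [hK a le_rfl]

end Moments

/-! ### The energies of `H` and its dilates -/

section Energy

open Finset

variable {p : ℕ} [Fact p.Prime] {t : ℕ} {H : Finset (ZMod p)}

/-- The number of pairs of distinct points `(x, y), (x', y')` of `H × H` such that
`x - l y = x' - l y'`, this common value being nonzero. -/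
def offDiagEnergy (H : Finset (ZMod p)) (l : ZMod p) : ℕ :=
  ∑ m with m ≠ 0, (repCount H l m ^ 2 - repCount H l m)

theorem offDiagEnergy_le (hc : #H = t) (l : ZMod p) : offDiagEnergy H l ≤ t ^ 3 := by
  calc offDiagEnergy H l ≤ ∑ m, (repCount H l m ^ 2 - repCount H l m) :=
        sum_le_sum_of_subset (filter_subset _ _)
    _ ≤ ∑ m, t * repCount H l m := by
        refine sum_le_sum fun m _ => (Nat.sub_le _ _).trans ?_
        rw [sq]
        exact Nat.mul_le_mul_right _ (hc ▸ repCount_le H l m)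
    _ = t ^ 3 := by rw [← mul_sum, sum_repCount, hc]; ring

theorem sum_offDiagEnergy_le (hc : #H = t) : ∑ l, offDiagEnergy H l ≤ t ^ 4 := by
  have h1 : ∑ l, offDiagEnergy H l + ∑ l, ∑ m, repCount H l m ≤ ∑ l, ∑ m, repCount H l m ^ 2 := by
    rw [← sum_add_distrib]
    refine sum_le_sum fun l _ => ?_
    refine (Nat.add_le_add_right (sum_le_sum_of_subset (filter_subset _ _)) _).trans ?_
    rw [← sum_add_distrib]
    exact sum_le_sum fun m _ => (Nat.sub_add_cancel (Nat.le_self_pow two_ne_zero _)).le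
  have h2 := sum_repCount_sq_le H
  rw [sum_congr rfl fun l _ => sum_repCount H l] at h1
  simp only [sum_const, card_univ, ZMod.card, smul_eq_mul, hc] at h1 h2
  omega

/-- Representations of multiplicity below `s ≈ τ / (2 t²)` contribute at most half of the energy of
a dilate `l` of energy at least `τ`; the others are controlled by
`pow_three_mul_card_popularPairs_le`. -/
theorem sq_mul_card_offDiagEnergy_le (ht : t ≠ 0) (hH : ∀ x, x ∈ H ↔ x ^ t = 1) (hc : #H = t)
    {τ : ℕ} (hτ1 : 512 * t ^ 2 ≤ τ) (hτ2 : 1024 * t ^ 4 ≤ τ * p) :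
    (τ : ℝ) ^ 2 * #{l ∈ ({l | l ≠ 0} : Finset (ZMod p)) | τ ≤ offDiagEnergy H l} ≤
      24 * 2 ^ 15 * (t : ℝ) ^ 6 := by
  have ht2 : 0 < 2 * t ^ 2 := by positivity
  set s := τ / (2 * t ^ 2) with hs
  have hs1 : 256 ≤ s := by
    rw [hs, Nat.le_div_iff_mul_le ht2]
    linarith
  have hsτ : 2 * t ^ 2 * s ≤ τ := Nat.mul_div_le _ _
  have hτs : τ ≤ 4 * t ^ 2 * s := by
    have h1 : τ < 2 * t ^ 2 * (s + 1) := Nat.lt_mul_div_succ τ ht2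
    nlinarith
  have hs2 : 256 * t ^ 2 ≤ s * p := by
    have h1 : 4 * t ^ 2 * (256 * t ^ 2) ≤ 4 * t ^ 2 * (s * p) := by
      calc 4 * t ^ 2 * (256 * t ^ 2) = 1024 * t ^ 4 := by ring
        _ ≤ τ * p := hτ2
        _ ≤ 4 * t ^ 2 * s * p := Nat.mul_le_mul_right _ hτs
        _ = _ := by ring
    exact le_of_mul_le_mul_left h1 (by positivity)
  set L := {l ∈ ({l | l ≠ 0} : Finset (ZMod p)) | τ ≤ offDiagEnergy H l} with hL
  set P : Finset (ZMod p × ZMod p) := {q | q.1 ≠ 0 ∧ q.2 ≠ 0} with hP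
  have hpop : ∀ j, ({q ∈ P | j ≤ repCount H q.1 q.2} : Finset _) = popularPairs H j := by
    intro j
    ext q
    simp [hP, popularPairs, and_assoc]
  have hlarge := sum_sq_mul_le_of_pow_three_mul_card_le P (fun q => repCount H q.1 q.2)
    (a := s) (by omega) (K := 2 ^ 15 * (t : ℝ) ^ 4) (fun j hj => by
      rw [hpop]
      exact_mod_cast pow_three_mul_card_popularPairs_le ht hH hc (hs1.trans hj)
        (hs2.trans (Nat.mul_le_mul_right _ hj)))
  have hsplit : #L * τ ≤ #L * (s * t ^ 2) +
      ∑ q ∈ P with s ≤ repCount H q.1 q.2, repCount H q.1 q.2 ^ 2 := by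
    have h1 : ∀ l, offDiagEnergy H l ≤ s * t ^ 2 +
        ∑ m with m ≠ 0, if s ≤ repCount H l m then repCount H l m ^ 2 else 0 := by
      intro l
      have h2 : s * t ^ 2 = ∑ m, s * repCount H l m := by
        rw [← mul_sum, sum_repCount, hc]
      have h3 : ∑ m with m ≠ 0, s * repCount H l m ≤ s * t ^ 2 :=
        h2 ▸ sum_le_sum_of_subset (filter_subset _ _)
      refine le_trans ?_ (Nat.add_le_add_right h3 _)
      rw [← sum_add_distrib]
      refine sum_le_sum fun m _ => (Nat.sub_le _ _).trans ?_
      split_ifs with h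
      · omega
      · rw [sq, add_zero]
        exact Nat.mul_le_mul_right _ (by omega)
    calc #L * τ ≤ ∑ l ∈ L, offDiagEnergy H l := by
          rw [← smul_eq_mul]
          exact card_nsmul_le_sum _ _ _ fun l hl => (mem_filter.mp hl).2
      _ ≤ ∑ l ∈ L, (s * t ^ 2 +
          ∑ m with m ≠ 0, if s ≤ repCount H l m then repCount H l m ^ 2 else 0) :=
          sum_le_sum fun l _ => h1 l
      _ = #L * (s * t ^ 2) + ∑ l ∈ L, ∑ m with m ≠ 0,
          (if s ≤ repCount H l m then repCount H l m ^ 2 else 0) := by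
          rw [sum_add_distrib, sum_const, smul_eq_mul]
      _ ≤ _ := by
          refine Nat.add_le_add_left ?_ _
          rw [← sum_product', sum_filter]
          refine sum_le_sum_of_subset fun q hq => ?_
          simp only [mem_product, hL, mem_filter, mem_univ, true_and] at hq
          simp only [hP, mem_filter, mem_univ, true_and]
          exact ⟨hq.1.1, hq.2⟩
  have hsplit' : (#L : ℝ) * τ ≤ #L * (s * (t : ℝ) ^ 2) +
      ∑ q ∈ P with s ≤ repCount H q.1 q.2, (repCount H q.1 q.2 : ℝ) ^ 2 := by
    exact_mod_cast hsplit
  set V := ∑ q ∈ P with s ≤ repCount H q.1 q.2, (repCount H q.1 q.2 : ℝ) ^ 2 with hV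
  have hV0 : 0 ≤ V := sum_nonneg fun _ _ => sq_nonneg _
  have hsτ' : 2 * (t : ℝ) ^ 2 * s ≤ τ := by exact_mod_cast hsτ
  have hτs' : (τ : ℝ) ≤ 4 * (t : ℝ) ^ 2 * s := by exact_mod_cast hτs
  have h2 : (#L : ℝ) * τ ≤ 2 * V := by
    have : (#L : ℝ) * (2 * (t : ℝ) ^ 2 * s) ≤ #L * τ := by gcongr
    linarith
  calc (τ : ℝ) ^ 2 * #L = τ * (#L * τ) := by ring
    _ ≤ τ * (2 * V) := by gcongr
    _ ≤ 4 * (t : ℝ) ^ 2 * s * (2 * V) := by gcongr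
    _ = 8 * (t : ℝ) ^ 2 * (V * s) := by ring
    _ ≤ 8 * (t : ℝ) ^ 2 * (3 * (2 ^ 15 * (t : ℝ) ^ 4)) := by gcongr
    _ = _ := by ring

/-- Energies below `a ≈ t² (1 + t² / p)` are controlled by the first moment `∑ E(l) ≤ t⁴`, larger ones
by their distribution `sq_mul_card_offDiagEnergy_le`. -/
theorem sum_offDiagEnergy_sq_le (ht : t ≠ 0) (hH : ∀ x, x ∈ H ↔ x ^ t = 1) (hc : #H = t) :
    ∑ l with l ≠ 0, (offDiagEnergy H l : ℝ) ^ 2 ≤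
      10 ^ 7 * ((t : ℝ) ^ 8 / p + (t : ℝ) ^ 6 * (1 + Real.log t)) := by
  have hp : 0 < p := (Fact.out : p.Prime).pos
  have hp' : (0 : ℝ) < p := by exact_mod_cast hp
  have ht1 : 1 ≤ t := by omega
  set a := 1024 * t ^ 2 * (t ^ 2 / p + 1) with ha
  have ha0 : 0 < a := by positivity
  have ha1 : 512 * t ^ 2 ≤ a := by
    rw [ha]
    nlinarith [Nat.zero_le (t ^ 2 * (t ^ 2 / p)), Nat.zero_le (t ^ 2)]
  have ha2 : 1024 * t ^ 4 ≤ a * p := by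
    have h1 : t ^ 2 < p * (t ^ 2 / p + 1) := Nat.lt_mul_div_succ _ hp
    calc 1024 * t ^ 4 = 1024 * t ^ 2 * t ^ 2 := by ring
      _ ≤ 1024 * t ^ 2 * (p * (t ^ 2 / p + 1)) := Nat.mul_le_mul_left _ h1.le
      _ = a * p := by rw [ha]; ring
  have ha3 : (a : ℝ) ≤ 1024 * (t : ℝ) ^ 2 * ((t : ℝ) ^ 2 / p + 1) := by
    have h1 : ((t ^ 2 / p : ℕ) : ℝ) ≤ (t : ℝ) ^ 2 / p := by
      have := Nat.cast_div_le (α := ℝ) (m := t ^ 2) (n := p)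
      exact_mod_cast this
    rw [ha]
    push_cast
    gcongr
  have hlarge := sum_sq_le_of_sq_mul_card_le ({l | l ≠ 0} : Finset (ZMod p)) (offDiagEnergy H)
    (a := a) (M := t ^ 3) ha0 (fun l _ => offDiagEnergy_le hc l)
    (fun j hj => sq_mul_card_offDiagEnergy_le ht hH hc (ha1.trans hj)
      (ha2.trans (Nat.mul_le_mul_right _ hj)))
  have hsmall : ∑ l ∈ ({l | l ≠ 0} : Finset (ZMod p)) with ¬ a ≤ offDiagEnergy H l,
      (offDiagEnergy H l : ℝ) ^ 2 ≤ a * (t : ℝ) ^ 4 := by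
    calc _ ≤ ∑ l ∈ ({l | l ≠ 0} : Finset (ZMod p)) with ¬ a ≤ offDiagEnergy H l,
          (a : ℝ) * offDiagEnergy H l := by
          refine sum_le_sum fun l hl => ?_
          have h1 : (offDiagEnergy H l : ℝ) ≤ a := by
            exact_mod_cast (not_le.mp (mem_filter.mp hl).2).le
          rw [sq]
          gcongr
      _ ≤ ∑ l, (a : ℝ) * offDiagEnergy H l :=
          sum_le_sum_of_subset_of_nonneg (subset_univ _) fun _ _ _ => by positivity
      _ ≤ a * (t : ℝ) ^ 4 := by
          rw [← mul_sum]
          gcongr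
          exact_mod_cast sum_offDiagEnergy_le hc
  rw [← sum_filter_add_sum_filter_not _ (fun l => a ≤ offDiagEnergy H l)]
  push_cast at hlarge
  rw [Real.log_pow] at hlarge
  push_cast at hlarge
  have hlog : 0 ≤ Real.log t := Real.log_nonneg (by exact_mod_cast ht1)
  have h1 : (a : ℝ) * (t : ℝ) ^ 4 ≤ 1024 * ((t : ℝ) ^ 8 / p) + 1024 * (t : ℝ) ^ 6 := by
    calc (a : ℝ) * (t : ℝ) ^ 4 ≤ 1024 * (t : ℝ) ^ 2 * ((t : ℝ) ^ 2 / p + 1) * (t : ℝ) ^ 4 := by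
          gcongr
      _ = _ := by ring
  have h2 : 0 ≤ (t : ℝ) ^ 8 / p := by positivity
  have h3 : 0 ≤ (t : ℝ) ^ 6 := by positivity
  have h4 : 0 ≤ (t : ℝ) ^ 6 * Real.log t := by positivity
  linarith

end Energy

/-! ### Reduction of the multiplicative equation to the energies -/

section Reduction

open Finset

variable {p : ℕ} [Fact p.Prime] {t : ℕ} {H : Finset (ZMod p)}

/-- The quadruples `(x, x', y, y')` of elements of `H` with `x - x' = l (y - y') ≠ 0`. -/
def proportionalDifferences (H : Finset (ZMod p)) (l : ZMod p) :
    Finset ((ZMod p × ZMod p) × (ZMod p × ZMod p)) :=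
  {q ∈ (H ×ˢ H) ×ˢ (H ×ˢ H) | q.1.1 - q.1.2 = l * (q.2.1 - q.2.2) ∧ q.1.1 - q.1.2 ≠ 0}

theorem card_proportionalDifferences_le (H : Finset (ZMod p)) (l : ZMod p) :
    #(proportionalDifferences H l) ≤ offDiagEnergy H l + repCount H l 0 ^ 2 := by
  have h1 : #(proportionalDifferences H l) ≤
      ∑ m, (repCount H l m ^ 2 - repCount H l m) := by
    rw [card_eq_sum_card_fiberwise (f := fun q => q.1.1 - l * q.2.1) (t := univ)
      fun _ _ => mem_coe.mpr (mem_univ _)]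
    refine sum_le_sum fun m _ => ?_
    rw [sq, repCount, ← offDiag_card]
    refine card_le_card_of_injOn (fun q => ((q.1.1, q.2.1), (q.1.2, q.2.2))) ?_ ?_
    · intro q hq
      simp only [proportionalDifferences, coe_filter, mem_filter, mem_product,
        Set.mem_ofPred_eq] at hq
      obtain ⟨⟨⟨⟨h1, h2⟩, h3, h4⟩, h5, h6⟩, h7⟩ := hq
      rw [mem_coe, mem_offDiag, mem_filter, mem_filter, mem_product, mem_product]
      refine ⟨⟨⟨h1, h3⟩, h7⟩, ⟨⟨h2, h4⟩, ?_⟩, ?_⟩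
      · simp only
        linear_combination h7 - h5
      · intro h
        rw [Prod.mk.injEq] at h
        exact h6 (sub_eq_zero.mpr h.1)
    · intro q _ r _ hqr
      simp only [Prod.mk.injEq] at hqr
      exact Prod.ext (Prod.ext hqr.1.1 hqr.2.1) (Prod.ext hqr.1.2 hqr.2.2)
  refine h1.trans ?_
  rw [← sum_filter_add_sum_filter_not univ (fun m : ZMod p => m ≠ 0)]
  refine Nat.add_le_add_left ?_ _
  have h2 : ({m | ¬ m ≠ 0} : Finset (ZMod p)) = {0} := by
    ext m
    simp
  rw [h2, sum_singleton]
  exact Nat.sub_le _ _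

theorem sum_repCount_zero_pow_four_le (hH : ∀ x, x ∈ H ↔ x ^ t = 1) (hc : #H = t) :
    ∑ l with l ≠ 0, repCount H l 0 ^ 4 ≤ t ^ 5 := by
  have h1 : ∀ l, repCount H l 0 ^ 4 ≤ if l ∈ H then t ^ 4 else 0 := by
    intro l
    split_ifs with hl
    · exact Nat.pow_le_pow_left (hc ▸ repCount_le H l 0) 4
    · have : repCount H l 0 = 0 := by
        refine card_eq_zero.mpr (filter_eq_empty_iff.mpr fun z hz hz0 => hl ?_)
        rw [mem_product, hH, hH] at hz
        rw [hH]
        have h2 := hz.1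
        rw [sub_eq_zero.mp hz0, mul_pow, hz.2, mul_one] at h2
        exact h2
      rw [this]
      norm_num
  calc ∑ l with l ≠ 0, repCount H l 0 ^ 4 ≤ ∑ l, repCount H l 0 ^ 4 :=
        sum_le_sum_of_subset (filter_subset _ _)
    _ ≤ ∑ l, if l ∈ H then t ^ 4 else 0 := sum_le_sum fun l _ => h1 l
    _ = t ^ 5 := by
        rw [← sum_filter, filter_mem_eq_inter, univ_inter, sum_const, hc, smul_eq_mul]
        ring

/-- The solutions with both sides zero number at most `4 t⁶`; the others are classified by the common
ratio `l = (u₁ - v₁) / (u₃ - v₃) = (u₄ - v₄) / (u₂ - v₂)`. -/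
theorem Dtimes_le (hH : ∀ x, x ∈ H ↔ x ^ t = 1) (hc : #H = t) (U : Set (ZMod p)ˣ)
    (hU : ∀ u ∈ U, (u : ZMod p) ∈ H) :
    Dtimes p U ≤ 4 * t ^ 6 + 2 * ∑ l with l ≠ 0, offDiagEnergy H l ^ 2 + 2 * t ^ 5 := by
  set Q := H ×ˢ H with hQ
  have hQc : #Q = t ^ 2 := by rw [hQ, card_product, hc, sq]
  set T : Finset (((ZMod p × ZMod p) × (ZMod p × ZMod p)) ×
      ((ZMod p × ZMod p) × (ZMod p × ZMod p))) :=
    {q ∈ (Q ×ˢ Q) ×ˢ (Q ×ˢ Q) | (q.1.1.1 - q.1.1.2) * (q.2.2.1 - q.2.2.2) =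
      (q.1.2.1 - q.1.2.2) * (q.2.1.1 - q.2.1.2)} with hT
  have hDT : Dtimes p U ≤ #T := by
    rw [Dtimes, ← Set.ncard_coe_finset]
    refine Set.ncard_le_ncard_of_injOn
      (fun w => ((((w.1 0 : ZMod p), (w.2 0 : ZMod p)), ((w.1 2 : ZMod p), (w.2 2 : ZMod p))),
        (((w.1 3 : ZMod p), (w.2 3 : ZMod p)), ((w.1 1 : ZMod p), (w.2 1 : ZMod p))))) ?_ ?_
    · rintro w ⟨hw1, hw2⟩
      have h1 : ∀ i, (w.1 i : ZMod p) ∈ H := fun i => hU _ (hw1 i).1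
      have h2 : ∀ i, (w.2 i : ZMod p) ∈ H := fun i => hU _ (hw1 i).2
      simp only [hT, hQ, coe_filter, mem_product, Set.mem_ofPred_eq]
      exact ⟨⟨⟨⟨h1 0, h2 0⟩, h1 2, h2 2⟩, ⟨h1 3, h2 3⟩, h1 1, h2 1⟩, hw2⟩
    · intro w _ x _ hwx
      simp only [Prod.mk.injEq, Units.val_inj] at hwx
      obtain ⟨⟨⟨h1, h2⟩, h3, h4⟩, ⟨h5, h6⟩, h7, h8⟩ := hwx
      refine Prod.ext (funext fun i => ?_) (funext fun i => ?_) <;> fin_cases i <;> assumption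
  set N : Finset ((ZMod p × ZMod p) × (ZMod p × ZMod p)) :=
    {q ∈ Q ×ˢ Q | (q.1.1 - q.1.2) * (q.2.1 - q.2.2) = 0} with hN
  have hNc : #N ≤ 2 * t ^ 3 := by
    set Q₀ : Finset (ZMod p × ZMod p) := {z ∈ Q | z.1 - 1 * z.2 = 0} with hQ₀
    have h0 : #Q₀ ≤ t := hc ▸ repCount_le H 1 0
    have h1 : N ⊆ (Q₀ ×ˢ Q) ∪ (Q ×ˢ Q₀) := by
      intro q hq
      rw [hN, mem_filter, mem_product, mul_eq_zero] at hq
      rcases hq.2 with h | h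
      · exact mem_union_left _ (mem_product.mpr
          ⟨mem_filter.mpr ⟨hq.1.1, by rwa [one_mul]⟩, hq.1.2⟩)
      · exact mem_union_right _ (mem_product.mpr
          ⟨hq.1.1, mem_filter.mpr ⟨hq.1.2, by rwa [one_mul]⟩⟩)
    refine (card_le_card h1).trans ((card_union_le _ _).trans ?_)
    rw [card_product Q₀ Q, card_product Q Q₀, hQc]
    nlinarith [Nat.zero_le (t ^ 2)]
  have hzero : #{q ∈ T | (q.1.1.1 - q.1.1.2) * (q.2.2.1 - q.2.2.2) = 0} ≤ 4 * t ^ 6 := by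
    have h1 : #{q ∈ T | (q.1.1.1 - q.1.1.2) * (q.2.2.1 - q.2.2.2) = 0} ≤ #(N ×ˢ N) := by
      refine card_le_card_of_injOn (fun q => ((q.1.1, q.2.2), (q.1.2, q.2.1))) ?_ ?_
      · intro q hq
        rw [mem_coe, mem_filter, hT, mem_filter] at hq
        obtain ⟨⟨hq1, hq2⟩, hq3⟩ := hq
        simp only [mem_product] at hq1
        simp only [mem_coe, mem_product, hN, mem_filter]
        exact ⟨⟨⟨hq1.1.1, hq1.2.2⟩, hq3⟩, ⟨hq1.1.2, hq1.2.1⟩, hq2 ▸ hq3⟩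
      · intro q _ r _ hqr
        simp only [Prod.mk.injEq] at hqr
        exact Prod.ext (Prod.ext hqr.1.1 hqr.2.1) (Prod.ext hqr.2.2 hqr.1.2)
    refine h1.trans ?_
    rw [card_product]
    calc #N * #N ≤ (2 * t ^ 3) * (2 * t ^ 3) := Nat.mul_le_mul hNc hNc
      _ = 4 * t ^ 6 := by ring
  have hnonzero : #{q ∈ T | ¬ (q.1.1.1 - q.1.1.2) * (q.2.2.1 - q.2.2.2) = 0} ≤
      ∑ l with l ≠ 0, #(proportionalDifferences H l) ^ 2 := by
    have h1 : ({q ∈ T | ¬ (q.1.1.1 - q.1.1.2) * (q.2.2.1 - q.2.2.2) = 0} : Finset _) ⊆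
        ({l | l ≠ 0} : Finset (ZMod p)).biUnion
          fun l => proportionalDifferences H l ×ˢ proportionalDifferences H l := by
      intro q hq
      rw [mem_filter, hT, mem_filter] at hq
      obtain ⟨⟨hq1, hq2⟩, hq3⟩ := hq
      have hq4 := hq3
      rw [hq2] at hq4
      obtain ⟨ha, hb⟩ := mul_ne_zero_iff.mp hq3
      obtain ⟨hd, he⟩ := mul_ne_zero_iff.mp hq4
      rw [mem_product] at hq1
      rw [mem_biUnion]
      refine ⟨(q.1.1.1 - q.1.1.2) / (q.1.2.1 - q.1.2.2), ?_, ?_⟩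
      · simpa using div_ne_zero ha hd
      · rw [mem_product, proportionalDifferences, mem_filter, mem_filter]
        refine ⟨⟨hq1.1, ?_, ha⟩, hq1.2, ?_, he⟩
        · rw [div_mul_cancel₀ _ hd]
        · rw [div_mul_eq_mul_div, eq_div_iff hd, hq2, mul_comm]
    refine (card_le_card h1).trans (card_biUnion_le.trans (sum_le_sum fun l _ => ?_))
    rw [card_product, sq]
  have hsum : ∑ l with l ≠ 0, #(proportionalDifferences H l) ^ 2 ≤
      2 * ∑ l with l ≠ 0, offDiagEnergy H l ^ 2 + 2 * t ^ 5 := by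
    calc ∑ l with l ≠ 0, #(proportionalDifferences H l) ^ 2
        ≤ ∑ l with l ≠ 0, (2 * offDiagEnergy H l ^ 2 + 2 * repCount H l 0 ^ 4) := by
          refine sum_le_sum fun l _ => ?_
          refine (Nat.pow_le_pow_left (card_proportionalDifferences_le H l) 2).trans ?_
          refine add_sq_le.trans_eq ?_
          ring
      _ = 2 * ∑ l with l ≠ 0, offDiagEnergy H l ^ 2 + 2 * ∑ l with l ≠ 0, repCount H l 0 ^ 4 := by
          rw [sum_add_distrib, mul_sum, mul_sum]
      _ ≤ _ := by
          have := sum_repCount_zero_pow_four_le hH hc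
          omega
  have hsplit := card_filter_add_card_filter_not (s := T)
    (fun q => (q.1.1.1 - q.1.1.2) * (q.2.2.1 - q.2.2.2) = 0)
  omega

/-- A subgroup of order `t` of the cyclic group `𝔽_p^*` consists of all the `t`-th roots of unity. -/
theorem exists_finset_subgroup (G : Subgroup (ZMod p)ˣ) : ∃ H : Finset (ZMod p),
    (∀ x, x ∈ H ↔ x ^ Nat.card G = 1) ∧ #H = Nat.card G ∧ ∀ u ∈ G, (u : ZMod p) ∈ H := by
  classical
  set K : Finset (ZMod p)ˣ := {u | u ∈ G} with hK
  have hKc : #K = Nat.card G := by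
    rw [Nat.card_eq_fintype_card, ← Fintype.card_subtype]
  have hpos : 0 < Nat.card G := Nat.card_pos
  have hpow : ∀ u ∈ G, u ^ Nat.card G = 1 := fun u hu =>
    congrArg Subtype.val (pow_card_eq_one' (x := (⟨u, hu⟩ : G)))
  have hKeq : K = ({u | u ^ Nat.card G = 1} : Finset (ZMod p)ˣ) := by
    refine eq_of_subset_of_card_le (fun u hu => ?_) ?_
    · simpa using hpow u (by simpa [hK] using hu)
    · rw [hKc]
      exact IsCyclic.card_pow_eq_one_le hpos
  refine ⟨K.image fun u : (ZMod p)ˣ => (u : ZMod p), fun x => ?_, ?_, fun u hu => ?_⟩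
  · rw [mem_image, hKeq]
    constructor
    · rintro ⟨u, hu, rfl⟩
      rw [mem_filter] at hu
      rw [← Units.val_pow_eq_pow_val, hu.2, Units.val_one]
    · intro hx
      have hx0 : x ≠ 0 := by
        rintro rfl
        rw [zero_pow hpos.ne'] at hx
        exact zero_ne_one hx
      refine ⟨Units.mk0 x hx0, ?_, rfl⟩
      rw [mem_filter, Units.ext_iff]
      exact ⟨mem_univ _, by simpa using hx⟩
  · rw [card_image_of_injective _ Units.val_injective, hKc]
  · exact mem_image_of_mem _ (by simpa [hK] using hu)

theorem Dtimes_subgroup_le (G : Subgroup (ZMod p)ˣ) :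
    (Dtimes p (G : Set (ZMod p)ˣ) : ℝ) ≤ 10 ^ 8 * ((Nat.card G : ℝ) ^ 8 / p +
      (Nat.card G : ℝ) ^ 6 * (1 + Real.log (Nat.card G))) := by
  obtain ⟨H, hH, hc, hG⟩ := exists_finset_subgroup G
  have hpos : 0 < Nat.card G := Nat.card_pos
  have h1 := Dtimes_le hH hc G hG
  have h2 := sum_offDiagEnergy_sq_le hpos.ne' hH hc
  set t := Nat.card G
  have h1' : (Dtimes p (G : Set (ZMod p)ˣ) : ℝ) ≤
      4 * (t : ℝ) ^ 6 + 2 * ∑ l with l ≠ 0, (offDiagEnergy H l : ℝ) ^ 2 + 2 * (t : ℝ) ^ 5 := by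
    exact_mod_cast h1
  have ht1 : (1 : ℝ) ≤ t := by exact_mod_cast hpos
  have h3 : (t : ℝ) ^ 5 ≤ (t : ℝ) ^ 6 := pow_le_pow_right₀ ht1 (by norm_num)
  have h4 : 0 ≤ (t : ℝ) ^ 6 * Real.log t := mul_nonneg (by positivity) (Real.log_nonneg ht1)
  have h5 : 0 ≤ (t : ℝ) ^ 8 / p := by positivity
  have h6 : 0 ≤ (t : ℝ) ^ 6 := by positivity
  linarith

end Reduction

theorem corollary3p4 :
    ∃ c : ℝ, 0 < c ∧ ∀ (p : ℕ) [Fact p.Prime] (G : Subgroup (ZMod p)ˣ),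
      (((p : ℝ) * Real.log (p : ℝ)) ^ (1 / 2 : ℝ) ≤ (Nat.card G : ℝ) →
        (Dtimes p (G : Set (ZMod p)ˣ) : ℝ) ≤ c * ((Nat.card G : ℝ) ^ 8 / (p : ℝ))) ∧
      ((Nat.card G : ℝ) < ((p : ℝ) * Real.log (p : ℝ)) ^ (1 / 2 : ℝ) → G ≠ ⊥ →
        (Dtimes p (G : Set (ZMod p)ˣ) : ℝ) ≤
          c * ((Nat.card G : ℝ) ^ 6 * Real.log (Nat.card G : ℝ))) := by
  refine ⟨10 ^ 9, by norm_num, fun p hp G => ?_⟩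
  have hD := Dtimes_subgroup_le G
  have hpos : 0 < Nat.card G := Nat.card_pos
  have htp : Nat.card G ≤ p := by
    have h1 : Nat.card G ≤ Nat.card (ZMod p)ˣ := Nat.card_le_card_of_injective _ G.subtype_injective
    rw [Nat.card_eq_fintype_card (α := (ZMod p)ˣ), ZMod.card_units] at h1
    omega
  have hbot : G ≠ ⊥ → 2 ≤ Nat.card G := fun h => by
    have := mt Subgroup.card_eq_one.mp h
    omega
  set t := Nat.card G
  have hp2 : (2 : ℝ) ≤ p := by exact_mod_cast hp.out.two_le
  have hp0 : (0 : ℝ) < p := by linarith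
  have ht1 : (1 : ℝ) ≤ t := by exact_mod_cast hpos
  have hlogp : 1 / 2 ≤ Real.log p := by
    have h1 := Real.log_le_log (by norm_num) hp2
    linarith [Real.log_two_gt_d9]
  have htp' : (t : ℝ) ≤ p := by exact_mod_cast htp
  have hlogt : Real.log t ≤ Real.log p := Real.log_le_log (by linarith) htp'
  have h6 : (0 : ℝ) < (t : ℝ) ^ 6 := by positivity
  have h8 : (t : ℝ) ^ 8 / p = (t : ℝ) ^ 6 * ((t : ℝ) ^ 2 / p) := by ring
  rw [← Real.sqrt_eq_rpow]
  constructor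
  · intro h
    have h1 : (p : ℝ) * Real.log p ≤ (t : ℝ) ^ 2 := (Real.sqrt_le_left (by linarith)).mp h
    have h2 : Real.log p ≤ (t : ℝ) ^ 2 / p := by
      rw [le_div_iff₀ hp0]
      linarith
    have h3 : (t : ℝ) ^ 6 * (1 + Real.log t) ≤ (t : ℝ) ^ 6 * (3 * ((t : ℝ) ^ 2 / p)) :=
      mul_le_mul_of_nonneg_left (by linarith) h6.le
    have h4 : 0 ≤ (t : ℝ) ^ 8 / p := by positivity
    rw [h8] at hD h4 ⊢
    linarith
  · intro h hG
    have ht2 : (2 : ℝ) ≤ t := by exact_mod_cast hbot hG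
    have h1 : (t : ℝ) ^ 2 < p * Real.log p := (Real.lt_sqrt (by linarith)).mp h
    have hlog2 : 1 / 2 ≤ Real.log t := by
      have h1 := Real.log_le_log (by norm_num) ht2
      linarith [Real.log_two_gt_d9]
    -- If `p < t²` then `log p < 2 log t`, and otherwise `t² / p ≤ 1`.
    have h2 : (t : ℝ) ^ 2 / p ≤ 2 * Real.log t := by
      rcases le_total ((t : ℝ) ^ 2) p with h3 | h3
      · exact ((div_le_one hp0).mpr h3).trans (by linarith)
      · have h4 := Real.log_le_log hp0 h3
        rw [Real.log_pow] at h4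
        push_cast at h4
        refine le_trans ?_ h4
        rw [div_le_iff₀ hp0]
        linarith
    have h3 : (t : ℝ) ^ 8 / p ≤ (t : ℝ) ^ 6 * (2 * Real.log t) := by
      rw [h8]
      exact mul_le_mul_of_nonneg_left h2 h6.le
    have h4 : (t : ℝ) ^ 6 * (1 + Real.log t) ≤ (t : ℝ) ^ 6 * (3 * Real.log t) :=
      mul_le_mul_of_nonneg_left (by linarith) h6.le
    have h5 : 0 ≤ (t : ℝ) ^ 6 * Real.log t := by positivity
    linarith
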